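/- Let $A\in\mathbb C^{n\times n}$, $b,d\in\mathbb C^n$, $t\in\mathbb R$, and consider the system $x'=Ax+bu$, $y=d^Hx$, whose scalar impulse response is $t\mapsto d^He^{tA}b$. Let $\lambda_1,\dots,\lambda_m\in\mathbb C$ (not necessarily distinct), and let $\varkappa_0,\dots,\varkappa_m$ and $\chi_0,\dots,\chi_m$ be nonnegative integers. Let $V\in\mathbb C^{n\times\hat n}$, $\hat n\ge1$, satisfy $V^HV=\mathbf 1$. Put $\Lambda=V^H$, $\widehat A=V^HAV$, $\hat b=V^Hb$, $\hat d=V^Hd$, and assume that no $\lambda_k$ ($1\le k\le m$) is an eigenvalue of $A$ or of $\widehat A$. Suppose that the vectors $$A^{j}b\ (0\le j<\varkappa_0),\qquad (\lambda_k\mathbf 1-A)^{-j}b\ (1\le k\le m,\ 1\le j\le\varkappa_k),$$ $$(A^H)^{j}d\ (0\le j<\chi_0),\qquad (\bar\lambda_k\mathbf 1-A^H)^{-j}d\ (1\le k\le m,\ 1\le j\le\chi_k),$$ taken together as one family, are linearly independent and form a basis of the image of $V$. Let $\hat\mu_1,\dots,\hat\mu_{\hat m}$ be the distinct eigenvalues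 of $\widehat A$, with algebraic multiplicities $\hat w_1,\dots,\hat w_{\hat m}$, and put $$v(\lambda)=\prod_{k=1}^m(\lambda-\lambda_k)^{\varkappa_k+\chi_k},\qquad \Omega(\lambda)=\prod_{k=1}^{\hat m}(\lambda-\hat\mu_k)^{\hat w_k},\qquad \exp_t(\lambda)=e^{\lambda t}.$$ Then $$\bigl|d^He^{tA}b-\hat d^He^{t\widehat A}\hat b\bigr|\le\max_{\substack{s\in[0,1]\\ \mu\in\operatorname{co}\{\hat\mu_1,\dots,\hat\mu_{\hat m}\}}}\Bigl|d^H\Bigl[\Omega(A)\,v(A)^{-1}\,\frac{(v\exp_t)^{(\hat n)}\bigl((1-s)\mu\mathbf 1+sA\bigr)}{\hat n!}\Bigr]b\Bigr|,$$ and the maximum is attained. Here $\operatorname{co}$ denotes the convex hull, $^{(\hat n)}$ the $\hat n$-th derivative in $\lambda$, and an entire function $f$ is applied to a matrix $B$ by $f(B)=\frac1{2\pi i}\oint_\Gamma f(\lambda)(\lambda\mathbf 1-B)^{-1}\,d\lambda$, with $\Gamma$ a contour enclosing the spectrum of $B$. -/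

import Mathlib

open scoped Matrix BigOperators

noncomputable section

/-- A radius that exceeds the modulus of every eigenvalue of `A`. -/
def enclosingRadius {N : ℕ} (A : Matrix (Fin N) (Fin N) ℂ) : ℝ :=
  1 + ∑ i, ∑ j, ‖A i j‖

/-- The circle about `0` of radius `enclosingRadius A` encloses the spectrum of `A`. -/
theorem norm_lt_enclosingRadius {N : ℕ} (A : Matrix (Fin N) (Fin N) ℂ) {z : ℂ}
    (hz : z ∈ spectrum ℂ A) : ‖z‖ < enclosingRadius A := by
  rw [← Matrix.spectrum_toLin', ← Module.End.hasEigenvalue_iff_mem_spectrum] at hz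
  obtain ⟨k, hk⟩ := eigenvalue_mem_ball hz
  rw [mem_closedBall_iff_norm] at hk
  have h1 : ‖z‖ ≤ ‖A k k‖ + ∑ j ∈ Finset.univ.erase k, ‖A k j‖ := by
    have := norm_add_le (z - A k k) (A k k)
    rw [sub_add_cancel] at this
    linarith
  rw [Finset.add_sum_erase _ (fun j => ‖A k j‖) (Finset.mem_univ k)] at h1
  have h2 : ∑ j, ‖A k j‖ ≤ ∑ i, ∑ j, ‖A i j‖ :=
    Finset.single_le_sum (f := fun i => ∑ j, ‖A i j‖)
      (fun i _ => Finset.sum_nonneg fun j _ => norm_nonneg _) (Finset.mem_univ k)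
  unfold enclosingRadius
  linarith

/-- An entire function `f` applied to a matrix `A`:
`f(A) = (2πi)⁻¹ ∮_Γ f(z) (z1 - A)⁻¹ dz` (entrywise), where the contour `Γ` is a circle that
encloses the spectrum of `A`. For entire `f` the value does not depend on the contour. -/
def entireMatrixFunction {N : ℕ} (f : ℂ → ℂ) (A : Matrix (Fin N) (Fin N) ℂ) :
    Matrix (Fin N) (Fin N) ℂ :=
  Matrix.of fun i j =>
    (2 * (Real.pi : ℂ) * Complex.I)⁻¹ *
      ∮ z in C(0, enclosingRadius A),
        f z * ((z • (1 : Matrix (Fin N) (Fin N) ℂ) - A)⁻¹ : Matrix (Fin N) (Fin N) ℂ) i j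

/-- The scalar impulse response `dᴴ e^{tA} b` of the system `x' = Ax + bu`, `y = dᴴx`. -/
def impulseResponse {N : ℕ} (A : Matrix (Fin N) (Fin N) ℂ) (b d : Fin N → ℂ) (t : ℝ) : ℂ :=
  star d ⬝ᵥ (NormedSpace.exp ((t : ℂ) • A) *ᵥ b)

/-- The matrix `Λ A V` of the reduced-order system, with `Λ = Vᴴ`. -/
def reducedMatrix {n nhat : ℕ} (V : Matrix (Fin n) (Fin nhat) ℂ)
    (A : Matrix (Fin n) (Fin n) ℂ) : Matrix (Fin nhat) (Fin nhat) ℂ :=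
  Vᴴ * A * V

/-- The vectors `Vᴴ b` and `Vᴴ d` of the reduced-order system. -/
def reducedVector {n nhat : ℕ} (V : Matrix (Fin n) (Fin nhat) ℂ) (b : Fin n → ℂ) :
    Fin nhat → ℂ :=
  Vᴴ *ᵥ b

/-- The rational Krylov vectors of `A` and `b` with poles at `∞` (multiplicity `κ₀`) and at the
points `lam k` (multiplicity `κ k`): `b, A b, …, A^(κ₀-1) b`, and
`(lam k - A)⁻¹ b, …, (lam k - A)^(-κ k) b` for each `k`. -/
def krylovVectors {n m : ℕ} (A : Matrix (Fin n) (Fin n) ℂ) (b : Fin n → ℂ)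
    (lam : Fin m → ℂ) (κ₀ : ℕ) (κ : Fin m → ℕ) :
    Fin κ₀ ⊕ (Σ k : Fin m, Fin (κ k)) → (Fin n → ℂ) :=
  Sum.elim
    (fun j => A ^ (j : ℕ) *ᵥ b)
    (fun p => ((lam p.1 • (1 : Matrix (Fin n) (Fin n) ℂ) - A)⁻¹) ^ ((p.2 : ℕ) + 1) *ᵥ b)

/-- All the vectors of the two-sided method: the rational Krylov vectors of `A`, `b` with poles
`lam k`, followed by those of `Aᴴ`, `d` with the conjugate poles. -/
def twoSidedKrylovVectors {n m : ℕ} (A : Matrix (Fin n) (Fin n) ℂ) (b d : Fin n → ℂ)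
    (lam : Fin m → ℂ) (κ₀ χ₀ : ℕ) (κ χ : Fin m → ℕ) :
    (Fin κ₀ ⊕ (Σ k : Fin m, Fin (κ k))) ⊕ (Fin χ₀ ⊕ (Σ k : Fin m, Fin (χ k))) →
      (Fin n → ℂ) :=
  Sum.elim (krylovVectors A b lam κ₀ κ)
    (krylovVectors Aᴴ d (fun k => star (lam k)) χ₀ χ)

/-- `v(z) = ∏ₖ (z - lam k)^(κ k + χ k)`. -/
def polePoly {m : ℕ} (lam : Fin m → ℂ) (κ χ : Fin m → ℕ) : Polynomial ℂ :=
  ∏ k, (Polynomial.X - Polynomial.C (lam k)) ^ (κ k + χ k)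

/-- `Ω(z) = ∏ₖ (z - μ k)^(w k)`. -/
def nodePoly {mhat : ℕ} (μ : Fin mhat → ℂ) (w : Fin mhat → ℕ) : Polynomial ℂ :=
  ∏ k, (Polynomial.X - Polynomial.C (μ k)) ^ w k

/-- The quantity
`|dᴴ [Ω(A) v(A)⁻¹ (v exp_t)^(N)((1-s)μ1 + sA) / N!] b|`. -/
def errorTerm {n : ℕ} (A : Matrix (Fin n) (Fin n) ℂ) (b d : Fin n → ℂ)
    (Ω v : Polynomial ℂ) (N : ℕ) (t s : ℝ) (μ : ℂ) : ℝ :=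
  ‖star d ⬝ᵥ
    ((Polynomial.aeval A Ω * (Polynomial.aeval A v)⁻¹ *
      ((N.factorial : ℂ)⁻¹ •
        entireMatrixFunction
          (iteratedDeriv N fun z : ℂ => v.eval z * Complex.exp (z * (t : ℂ)))
          (((1 - (s : ℂ)) * μ) • (1 : Matrix (Fin n) (Fin n) ℂ) + (s : ℂ) • A))) *ᵥ b)‖

end

/-! Put `Â = VᴴAV`, `b̂ = Vᴴb`, `d̂ = Vᴴd`, and on pairs of matrices consider the functional `Ψ(X,
Y) = dᴴ v(A)⁻¹ X b - d̂ᴴ v(Â)⁻¹ Y b̂`. On the pair `(A, Â)` the function `v exp_t` gives `Ψ((v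
exp_t)(A, Â)) = dᴴe^{tA}b - d̂ᴴe^{tÂ}b̂`, the error to be bounded.

Two-sided moment matching says that `Ψ` kills `(A, Â)^j` for `j < n̂`. Each Krylov space is
reproduced exactly by the projection, and a power `A^j` with `j < n̂` can be split between the two
sides, with at most one factor `A` left in the middle, where `VᴴAV = Â` absorbs it.

A functional that kills the powers below `n̂` sees only the Hermite interpolation remainder.
`norm_apply_expPoly_le` estimates it without divided differences: peel off one node `μ`, join a
scalar to the target point by a segment, and integrate the derivative, which carries a factor `a -
μ`. Repeating this `n̂` times produces `Ω(a)`, the `n̂`-th derivative and `1/n̂!`. With the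
eigenvalues of `Â` as nodes, Cayley-Hamilton gives `Ω(Â) = 0`, so only the `A` component survives in
the bound. The contour integrals are identified with `q(B)e^{tB}` by
`entireMatrixFunction_eval_mul_exp`. -/

open Polynomial

open scoped Pointwise

/-! ### Hermite interpolation remainder in a Banach algebra -/

section BanachAlgebra

variable {𝒜 : Type*} [NormedRing 𝒜] [NormedAlgebra ℂ 𝒜]

/-- The function `x ↦ q(x) e^{tx}` on a Banach algebra. -/
noncomputable def expPoly (t : ℂ) (q : ℂ[X]) (x : 𝒜) : 𝒜 :=
  aeval x q * NormedSpace.exp (t • x)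

/-- The map `q ↦ q' + tq`, so that `(q e^{tz})' = (q' + tq) e^{tz}`. -/
noncomputable def derivExpPoly (t : ℂ) (q : ℂ[X]) : ℂ[X] :=
  derivative q + C t * q

/-- Every path of integration below starts at a scalar; hence a functional that kills `1` vanishes
at the start. -/
theorem expPoly_algebraMap_mem (t e : ℂ) (q : ℂ[X]) :
    ∃ c : ℂ, expPoly t q (algebraMap ℂ 𝒜 e) = algebraMap ℂ 𝒜 c := by
  refine ⟨q.eval e * NormedSpace.exp (t * e), ?_⟩
  rw [expPoly, aeval_algebraMap_apply, map_mul, Algebra.smul_def, ← map_mul,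
    NormedSpace.algebraMap_exp_comm]
  simp

/-- The points of the line commute with its direction `y`, so the scalar chain rule survives in a
noncommutative algebra. -/
theorem hasDerivAt_aeval_affine (e : ℂ) (y : 𝒜) (q : ℂ[X]) (z : ℂ) :
    HasDerivAt (fun z : ℂ => aeval (algebraMap ℂ 𝒜 e + z • y) q)
      (y * aeval (algebraMap ℂ 𝒜 e + z • y) (derivative q)) z := by
  have hx : HasDerivAt (fun z : ℂ => algebraMap ℂ 𝒜 e + z • y) y z := by
    simpa using ((hasDerivAt_id z).smul_const y).const_add (algebraMap ℂ 𝒜 e)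
  have hcomm : Commute y (algebraMap ℂ 𝒜 e + z • y) :=
    (Algebra.commute_algebraMap_right e y).add_right ((Commute.refl y).smul_right z)
  induction q using Polynomial.induction_on' with
  | add p q hp hq => simpa only [map_add, mul_add] using hp.fun_add hq
  | monomial k c =>
    have hpow : ∀ k : ℕ, HasDerivAt (fun z : ℂ => (algebraMap ℂ 𝒜 e + z • y) ^ k)
        (y * ((k : ℂ) • (algebraMap ℂ 𝒜 e + z • y) ^ (k - 1))) z := by
      intro k
      induction k with
      | zero => simpa using hasDerivAt_const z (1 : 𝒜)
      | succ k ih =>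
        simp only [pow_succ]
        refine (ih.mul hx).congr_deriv ?_
        have h1 := (hcomm.pow_right k).eq
        rw [← h1, Nat.add_sub_cancel]
        rcases k with _ | k
        · simp
        · simp only [Nat.add_sub_cancel, mul_assoc, smul_mul_assoc, ← pow_succ, mul_smul_comm]
          push_cast
          simp only [add_smul, one_smul]
    simp only [aeval_monomial, derivative_monomial]
    refine ((hpow k).const_mul (algebraMap ℂ 𝒜 c)).congr_deriv ?_
    rw [← mul_assoc, Algebra.commutes c y, mul_assoc, map_mul, mul_assoc, map_natCast,
      ← nsmul_eq_mul, Nat.cast_smul_eq_nsmul]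

variable [CompleteSpace 𝒜]

theorem hasDerivAt_expPoly_affine (t e : ℂ) (y : 𝒜) (q : ℂ[X]) (z : ℂ) :
    HasDerivAt (fun z : ℂ => expPoly t q (algebraMap ℂ 𝒜 e + z • y))
      (y * expPoly t (derivExpPoly t q) (algebraMap ℂ 𝒜 e + z • y)) z := by
  have hexp : ∀ z : ℂ, NormedSpace.exp (t • (algebraMap ℂ 𝒜 e + z • y)) =
      NormedSpace.exp (t • algebraMap ℂ 𝒜 e) * NormedSpace.exp (z • (t • y)) := by
    intro z
    rw [smul_add, smul_comm t z y]
    let _ : NormedAlgebra ℚ 𝒜 := NormedAlgebra.restrictScalars ℚ ℂ 𝒜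
    refine NormedSpace.exp_add_of_commute ?_
    exact (((Algebra.commute_algebraMap_left e y).smul_left t).smul_right t).smul_right z
  have hd : HasDerivAt (fun z : ℂ => NormedSpace.exp (t • (algebraMap ℂ 𝒜 e + z • y)))
      ((t • y) * NormedSpace.exp (t • (algebraMap ℂ 𝒜 e + z • y))) z := by
    simp only [hexp]
    refine ((hasDerivAt_exp_smul_const' (𝕂 := ℂ) (t • y) z).const_mul _).congr_deriv ?_
    have : Commute (NormedSpace.exp (t • algebraMap ℂ 𝒜 e)) (t • y) := by
      let _ : NormedAlgebra ℚ 𝒜 := NormedAlgebra.restrictScalars ℚ ℂ 𝒜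
      exact Commute.exp_left (((Algebra.commute_algebraMap_left e y).smul_left t).smul_right t)
    rw [← mul_assoc, this.eq, mul_assoc]
  refine ((hasDerivAt_aeval_affine e y q z).mul hd).congr_deriv ?_
  have hcomm : Commute (aeval (algebraMap ℂ 𝒜 e + z • y) q) y := by
    have h0 : Commute y (algebraMap ℂ 𝒜 e + z • y) :=
      (Algebra.commute_algebraMap_right e y).add_right ((Commute.refl y).smul_right z)
    induction q using Polynomial.induction_on' with
    | add p q hp hq => simpa only [map_add] using hp.add_left hq
    | monomial k c =>
      rw [aeval_monomial]
      exact (Algebra.commute_algebraMap_left c y).mul_left (h0.symm.pow_left k)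
  simp only [expPoly, derivExpPoly, map_add, map_mul, aeval_C, mul_add, add_mul, mul_assoc,
    smul_mul_assoc, mul_smul_comm]
  congr 1
  rw [← mul_assoc, hcomm.eq, mul_assoc, ← Algebra.smul_def, mul_smul_comm]

/-- The error bound for Hermite interpolation in a Banach algebra, in dual form. -/
theorem norm_apply_expPoly_le (t : ℂ) (a : 𝒜) {K : Set ℂ} (hK : Convex ℝ K) {M : ℝ}
    (l : List ℂ) :
    ∀ (Ψ : 𝒜 →L[ℂ] ℂ) (q : ℂ[X]), (∀ μ ∈ l, μ ∈ K) → (∀ j < l.length, Ψ (a ^ j) = 0) →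
      (∀ s ∈ Set.Icc (0 : ℝ) 1, ∀ c ∈ (1 - s) • K,
        ‖Ψ (aeval a (l.map fun μ => X - C μ).prod *
          expPoly t ((derivExpPoly t)^[l.length] q) (algebraMap ℂ 𝒜 c + (s : ℂ) • a))‖ ≤ M) →
      ∀ r ∈ Set.Icc (0 : ℝ) 1, ∀ c ∈ (1 - r) • K,
        ‖Ψ (expPoly t q (algebraMap ℂ 𝒜 c + (r : ℂ) • a))‖ ≤ M * r ^ l.length / l.length.factorial := by
  -- The estimate is claimed at all points `c + r a` with `c ∈ (1 - r)K`, since the inductive step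
  -- needs it along a whole segment.
  induction l with
  | nil =>
    intro Ψ q _ _ hM r hr c hc
    simpa using hM r hr c hc
  | cons μ l ih =>
    intro Ψ q hl hΨ hM r hr c hc
    -- The factor `a - μ` is moved into the functional, at the cost of one vanishing power.
    set Ψ' : 𝒜 →L[ℂ] ℂ := Ψ.comp (ContinuousLinearMap.mul ℂ 𝒜 (a - algebraMap ℂ 𝒜 μ)) with hΨ'
    have hΨ'_apply : ∀ x, Ψ' x = Ψ ((a - algebraMap ℂ 𝒜 μ) * x) := fun x => rfl
    have key := ih Ψ' (derivExpPoly t q) (fun ν hν => hl ν (List.mem_cons_of_mem _ hν))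
      (fun j hj => by
        rw [hΨ'_apply, sub_mul, ← pow_succ', ← Algebra.smul_def, map_sub, map_smul,
          hΨ _ (by simpa using hj), hΨ _ (by simp; omega)]
        simp)
      (fun s hs c hc => by
        have := hM s hs c hc
        rw [List.length_cons, Function.iterate_succ_apply, List.map_cons, List.prod_cons,
          map_mul (aeval a), mul_assoc, map_sub, aeval_X, aeval_C] at this
        rwa [hΨ'_apply])
    -- The segment `e + s y` runs from the scalar `c + r μ` to `c + r a`; its points have the same
    -- form, with `r s` in place of `r`.
    set e : ℂ := c + r * μ with he
    set y : 𝒜 := (r : ℂ) • (a - algebraMap ℂ 𝒜 μ) with hy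
    have hpath : ∀ s : ℝ, algebraMap ℂ 𝒜 e + (s : ℂ) • y =
        algebraMap ℂ 𝒜 (c + r * (1 - s) * μ) + ((r * s : ℝ) : ℂ) • a := by
      intro s
      simp only [he, hy, Algebra.algebraMap_eq_smul_one]
      push_cast
      module
    have hderiv : ∀ s : ℝ, HasDerivAt
        (fun s : ℝ => Ψ (expPoly t q (algebraMap ℂ 𝒜 e + (s : ℂ) • y)))
        (Ψ (y * expPoly t (derivExpPoly t q) (algebraMap ℂ 𝒜 e + (s : ℂ) • y))) s := fun s =>
      (Ψ.hasFDerivAt.comp_hasDerivAt (s : ℂ)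
        (hasDerivAt_expPoly_affine t e y q s)).comp_ofReal
    have hB : ∀ s : ℝ, HasDerivAt
        (fun s : ℝ => M * (r * s) ^ (l.length + 1) / (l.length + 1).factorial)
        (r * (M * (r * s) ^ l.length / l.length.factorial)) s := by
      intro s
      have h1 : HasDerivAt (fun s : ℝ => r * s) r s := by
        simpa using (hasDerivAt_id s).const_mul r
      refine (((h1.pow (l.length + 1)).const_mul M).div_const _).congr_deriv ?_
      rw [Nat.factorial_succ]
      have : (l.length.factorial : ℝ) ≠ 0 := by positivity
      have : (l.length + 1 : ℝ) ≠ 0 := by positivity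
      push_cast
      field_simp
    have hfin := image_norm_le_of_norm_deriv_right_le_deriv_boundary (a := (0 : ℝ)) (b := 1)
      (f := fun s : ℝ => Ψ (expPoly t q (algebraMap ℂ 𝒜 e + (s : ℂ) • y)))
      (B := fun s : ℝ => M * (r * s) ^ (l.length + 1) / (l.length + 1).factorial)
      (fun s _ => (hderiv s).continuousAt.continuousWithinAt)
      (fun s _ => (hderiv s).hasDerivWithinAt)
      (by
        obtain ⟨c', hc'⟩ := expPoly_algebraMap_mem (𝒜 := 𝒜) t e q
        have h0 := hΨ 0 (by simp)
        rw [pow_zero] at h0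
        simp only [Complex.ofReal_zero, zero_smul, add_zero, hc']
        simp [Algebra.algebraMap_eq_smul_one, h0])
      hB
      (fun s hs => by
        have hs' : s ∈ Set.Icc (0 : ℝ) 1 := ⟨hs.1, hs.2.le⟩
        have hrs : r * s ∈ Set.Icc (0 : ℝ) 1 :=
          ⟨mul_nonneg hr.1 hs'.1, mul_le_one₀ hr.2 hs'.1 hs'.2⟩
        have hmem : c + r * (1 - s) * μ ∈ (1 - r * s) • K := by
          -- Convexity of `K` enters here, as `(1 - r)K + r(1 - s)K = (1 - rs)K`.
          have h1 : (1 - r * s) = (1 - r) + r * (1 - s) := by ring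
          rw [h1, hK.add_smul (by linarith [hr.2]) (mul_nonneg hr.1 (by linarith [hs'.2]))]
          refine Set.add_mem_add hc ⟨μ, hl μ (by simp), ?_⟩
          simp
        have h2 := key (r * s) hrs _ hmem
        rw [← hpath, hΨ'_apply] at h2
        rw [hy, smul_mul_assoc, map_smul, norm_smul, ← hy, Complex.norm_real, Real.norm_eq_abs,
          abs_of_nonneg hr.1]
        exact mul_le_mul_of_nonneg_left h2 hr.1)
      (x := 1) ⟨zero_le_one, le_rfl⟩
    simp only [hpath] at hfin
    simpa using hfin

end BanachAlgebra

/-! ### The contour integral calculus agrees with power series -/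

section ContourIntegral

open scoped Matrix.Norms.Operator

theorem hasSum_circleIntegral_of_summable_bound {F : ℕ → ℂ → ℂ} {f : ℂ → ℂ} {R : ℝ} (hR : 0 ≤ R)
    (u : ℕ → ℝ) (hu : Summable u) (hF : ∀ k, ContinuousOn (F k) (Metric.sphere 0 R))
    (hFu : ∀ k, ∀ z ∈ Metric.sphere (0 : ℂ) R, ‖F k z‖ ≤ u k)
    (hsum : ∀ z ∈ Metric.sphere (0 : ℂ) R, HasSum (fun k => F k z) (f z)) :
    HasSum (fun k => ∮ z in C(0, R), F k z) (∮ z in C(0, R), f z) := by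
  have hmem : ∀ θ, circleMap 0 R θ ∈ Metric.sphere (0 : ℂ) R := circleMap_mem_sphere 0 hR
  refine intervalIntegral.hasSum_integral_of_dominated_convergence
    (fun k _ => R * u k) (fun k => ?_) (fun k => ?_) ?_ ?_ ?_
  · have h1 : Continuous fun θ => F k (circleMap 0 R θ) :=
      (hF k).comp_continuous (continuous_circleMap 0 R) hmem
    simp only [deriv_circleMap]
    exact (((continuous_circleMap 0 R).mul continuous_const).smul h1).aestronglyMeasurable
  · refine Filter.Eventually.of_forall fun θ _ => ?_
    have := mul_le_mul_of_nonneg_left (hFu k _ (hmem θ)) hR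
    simpa [abs_of_nonneg hR] using this
  · exact Filter.Eventually.of_forall fun _ _ => hu.mul_left R
  · exact intervalIntegrable_const
  · exact Filter.Eventually.of_forall fun θ _ => (hsum _ (hmem θ)).const_smul _

variable {N : ℕ} (B : Matrix (Fin N) (Fin N) ℂ)

theorem enclosingRadius_pos : 0 < enclosingRadius B := by
  unfold enclosingRadius
  positivity

/-- This makes the Neumann series of the resolvent converge on the whole contour. -/
theorem linfty_opNorm_lt_enclosingRadius : ‖B‖ < enclosingRadius B := by
  refine lt_of_le_of_lt ?_ (lt_one_add _)
  rw [Matrix.linfty_opNorm_def]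
  have : (Finset.univ.sup fun i => ∑ j, ‖B i j‖₊) ≤ ∑ i, ∑ j, ‖B i j‖₊ :=
    Finset.sup_le fun i _ => Finset.single_le_sum (f := fun i => ∑ j, ‖B i j‖₊)
      (fun _ _ => zero_le) (Finset.mem_univ i)
  simpa only [NNReal.coe_sum, coe_nnnorm] using NNReal.coe_le_coe.2 this

theorem norm_apply_le_linfty_opNorm (i j : Fin N) : ‖B i j‖ ≤ ‖B‖ := by
  rw [Matrix.linfty_opNorm_def]
  have h1 : ‖B i j‖₊ ≤ ∑ j, ‖B i j‖₊ :=
    Finset.single_le_sum (f := fun j => ‖B i j‖₊) (fun _ _ => zero_le) (Finset.mem_univ j)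
  exact_mod_cast h1.trans (Finset.le_sup (f := fun i => ∑ j, ‖B i j‖₊) (Finset.mem_univ i))

theorem isUnit_resolvent_of_mem_sphere {z : ℂ} (hz : z ∈ Metric.sphere 0 (enclosingRadius B)) :
    IsUnit (z • (1 : Matrix (Fin N) (Fin N) ℂ) - B) := by
  by_contra h
  have hmem : z ∈ spectrum ℂ B := by
    rw [spectrum.mem_iff, Algebra.algebraMap_eq_smul_one]
    exact h
  have := norm_lt_enclosingRadius B hmem
  rw [mem_sphere_zero_iff_norm] at hz
  linarith

theorem continuousOn_resolvent_apply (i j : Fin N) :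
    ContinuousOn (fun z : ℂ => (z • (1 : Matrix (Fin N) (Fin N) ℂ) - B)⁻¹ i j)
      (Metric.sphere 0 (enclosingRadius B)) := by
  have hc : Continuous fun z : ℂ => z • (1 : Matrix (Fin N) (Fin N) ℂ) - B := by fun_prop
  simp only [Matrix.inv_def, Ring.inverse_eq_inv', Matrix.smul_apply, smul_eq_mul]
  refine ContinuousOn.mul (ContinuousOn.inv₀ hc.matrix_det.continuousOn fun z hz => ?_)
    ((hc.matrix_adjugate).matrix_elem i j).continuousOn
  exact ((Matrix.isUnit_iff_isUnit_det _).1 (isUnit_resolvent_of_mem_sphere B hz)).ne_zero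

theorem hasSum_resolvent_apply {z : ℂ} (hz : z ∈ Metric.sphere 0 (enclosingRadius B))
    (i j : Fin N) :
    HasSum (fun k : ℕ => z ^ (-(k : ℤ) - 1) * (B ^ k) i j)
      ((z • (1 : Matrix (Fin N) (Fin N) ℂ) - B)⁻¹ i j) := by
  have hR := enclosingRadius_pos B
  rw [mem_sphere_zero_iff_norm] at hz
  have hz0 : z ≠ 0 := by
    rintro rfl
    simp at hz
    linarith
  have hlt : ‖z⁻¹ • B‖ < 1 := by
    rw [norm_smul, norm_inv, hz, inv_mul_lt_one₀ hR]
    exact linfty_opNorm_lt_enclosingRadius B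
  have hs := (summable_geometric_of_norm_lt_one hlt).hasSum
  have hinv : (z • (1 : Matrix (Fin N) (Fin N) ℂ) - B)⁻¹ = z⁻¹ • ∑' k : ℕ, (z⁻¹ • B) ^ k := by
    refine Matrix.inv_eq_right_inv ?_
    refine Eq.trans ?_ (mul_neg_geom_series _ hlt)
    rw [mul_smul_comm, ← smul_mul_assoc, smul_sub, smul_smul,
      inv_mul_cancel₀ hz0, one_smul]
    rfl
  rw [hinv]
  have h1 := (hs.const_smul z⁻¹).map
    (Matrix.entryAddMonoidHom ℂ i j) (continuous_id.matrix_elem i j)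
  convert! h1 using 1
  funext k
  simp only [Function.comp_apply, Matrix.entryAddMonoidHom_apply, _root_.smul_pow, smul_smul,
    Matrix.smul_apply, smul_eq_mul]
  have h2 : z ^ (-(k : ℤ) - 1) = z⁻¹ * z⁻¹ ^ k := by
    rw [← pow_succ', inv_pow, ← zpow_natCast, ← zpow_neg]
    congr 1
    push_cast
    ring
  rw [h2, mul_assoc]

/-- The Neumann series is integrated term by term; only the term in `z⁻¹` contributes. -/
theorem circleIntegral_pow_mul_resolvent (k : ℕ) (i j : Fin N) :
    (∮ z in C(0, enclosingRadius B), z ^ k *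
      (z • (1 : Matrix (Fin N) (Fin N) ℂ) - B)⁻¹ i j) = 2 * Real.pi * Complex.I * (B ^ k) i j := by
  have hR := enclosingRadius_pos B
  set R := enclosingRadius B with hRdef
  -- A nonempty index type gives `‖1‖ = 1`, which `norm_pow_le` assumes.
  have : Nonempty (Fin N) := ⟨i⟩
  have hsum := hasSum_circleIntegral_of_summable_bound
    (F := fun l z => z ^ k * (z ^ (-(l : ℤ) - 1) * (B ^ l) i j))
    (f := fun z => z ^ k * (z • (1 : Matrix (Fin N) (Fin N) ℂ) - B)⁻¹ i j) hR.le
    (fun l => R ^ k * R⁻¹ * (‖B‖ / R) ^ l)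
    ((summable_geometric_of_lt_one (by positivity)
      ((div_lt_one hR).2 (linfty_opNorm_lt_enclosingRadius B))).mul_left _)
    (fun l => by
      refine (continuousOn_id.pow k).mul (ContinuousOn.mul (fun z hz => ?_) continuousOn_const)
      refine (continuousAt_zpow₀ z _ (Or.inl ?_)).continuousWithinAt
      rintro rfl
      simp at hz
      linarith)
    (fun l z hz => by
      rw [mem_sphere_zero_iff_norm] at hz
      have h1 : ‖(B ^ l) i j‖ ≤ ‖B‖ ^ l :=
        (norm_apply_le_linfty_opNorm _ i j).trans (norm_pow_le B l)
      have h2 : R ^ (-(l : ℤ) - 1) = R⁻¹ * (R ^ l)⁻¹ := by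
        rw [zpow_sub₀ hR.ne', zpow_neg, zpow_natCast, zpow_one, div_eq_mul_inv, mul_comm]
      rw [norm_mul, norm_mul, norm_pow, norm_zpow, hz, h2, div_pow, div_eq_mul_inv]
      calc R ^ k * (R⁻¹ * (R ^ l)⁻¹ * ‖(B ^ l) i j‖)
          ≤ R ^ k * (R⁻¹ * (R ^ l)⁻¹ * ‖B‖ ^ l) := by gcongr
        _ = _ := by ring)
    (fun z hz => (hasSum_resolvent_apply B hz i j).mul_left _)
  have hterm : ∀ l : ℕ, (∮ z in C(0, R), z ^ k * (z ^ (-(l : ℤ) - 1) * (B ^ l) i j)) =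
      if l = k then 2 * Real.pi * Complex.I * (B ^ k) i j else 0 := by
    intro l
    have h1 : (∮ z in C(0, R), z ^ k * (z ^ (-(l : ℤ) - 1) * (B ^ l) i j)) =
        (∮ z in C(0, R), (B ^ l) i j * (z - 0) ^ ((k : ℤ) - l - 1)) := by
      refine circleIntegral.integral_congr hR.le fun z hz => ?_
      have hz0 : z ≠ 0 := by
        rintro rfl
        simp at hz
        linarith
      have : (k : ℤ) - l - 1 = k + (-(l : ℤ) - 1) := by ring
      simp only [sub_zero]
      rw [this, zpow_add₀ hz0 (k : ℤ), zpow_natCast]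
      ring
    rw [h1, circleIntegral.integral_const_mul]
    split_ifs with h
    · subst h
      have : (l : ℤ) - l - 1 = -1 := by ring
      simp only [this, zpow_neg_one]
      rw [circleIntegral.integral_sub_center_inv _ hR.ne', mul_comm]
    · rw [circleIntegral.integral_sub_zpow_of_ne (by omega), mul_zero]
  simp only [hterm] at hsum
  exact hsum.unique (hasSum_ite_eq k _)

/-- By linearity `q` is a monomial; the exponential series is then integrated term by term. -/
theorem entireMatrixFunction_eval_mul_exp (t : ℂ) (q : ℂ[X]) :
    entireMatrixFunction (fun z => q.eval z * Complex.exp (z * t)) B = expPoly t q B := by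
  have hR := enclosingRadius_pos B
  have hpi : (2 * (Real.pi : ℂ) * Complex.I) ≠ 0 := Complex.two_pi_I_ne_zero
  induction q using Polynomial.induction_on' with
  | add p q hp hq =>
    rw [expPoly, map_add, add_mul, ← expPoly, ← expPoly, ← hp, ← hq]
    ext i j
    have hint : ∀ p : ℂ[X], CircleIntegrable (fun z => p.eval z * Complex.exp (z * t) *
        (z • (1 : Matrix (Fin N) (Fin N) ℂ) - B)⁻¹ i j) 0 (enclosingRadius B) := fun p =>
      (ContinuousOn.mul (by fun_prop) (continuousOn_resolvent_apply B i j)).circleIntegrable hR.le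
    simp only [entireMatrixFunction, Matrix.of_apply, Matrix.add_apply, eval_add, add_mul]
    rw [circleIntegral.integral_add (hint p) (hint q), mul_add]
  | monomial k c =>
    ext i j
    obtain ⟨C, hC⟩ := (isCompact_sphere (0 : ℂ) (enclosingRadius B)).exists_bound_of_continuousOn
      (continuousOn_resolvent_apply B i j)
    have hsum := hasSum_circleIntegral_of_summable_bound
      (F := fun l z => (c * t ^ l / l.factorial) * (z ^ (k + l) *
        (z • (1 : Matrix (Fin N) (Fin N) ℂ) - B)⁻¹ i j))
      (f := fun z => (monomial k c).eval z * Complex.exp (z * t) *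
        (z • (1 : Matrix (Fin N) (Fin N) ℂ) - B)⁻¹ i j) hR.le
      (fun l => ‖c‖ * enclosingRadius B ^ k * C *
        ((enclosingRadius B * ‖t‖) ^ l / l.factorial))
      ((Real.summable_pow_div_factorial _).mul_left _)
      (fun l => continuousOn_const.mul
        ((continuousOn_id.pow _).mul (continuousOn_resolvent_apply B i j)))
      (fun l z hz => by
        have h1 := hC z hz
        rw [mem_sphere_zero_iff_norm] at hz
        rw [norm_mul, norm_mul, norm_div, norm_mul, norm_pow, norm_pow, hz, Complex.norm_natCast]
        calc _ ≤ ‖c‖ * ‖t‖ ^ l / l.factorial * (enclosingRadius B ^ (k + l) * C) := by gcongr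
          _ = _ := by rw [mul_pow, pow_add]; ring)
      (fun z _ => by
        have h1 : HasSum (fun l : ℕ => (z * t) ^ l / l.factorial) (Complex.exp (z * t)) := by
          rw [Complex.exp_eq_exp_ℂ]
          exact NormedSpace.expSeries_div_hasSum_exp (z * t)
        rw [eval_monomial]
        convert! (h1.mul_left (c * z ^ k)).mul_right
          ((z • (1 : Matrix (Fin N) (Fin N) ℂ) - B)⁻¹ i j) using 1
        funext l
        rw [mul_pow, pow_add]
        ring)
    simp only [circleIntegral.integral_const_mul, circleIntegral_pow_mul_resolvent] at hsum
    have hexp : HasSum (fun l : ℕ => (c * t ^ l / l.factorial) • B ^ (k + l))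
        (expPoly t (monomial k c) B) := by
      have h1 := (NormedSpace.exp_series_hasSum_exp' (𝕂 := ℂ) (t • B)).mul_left
        (algebraMap ℂ _ c * B ^ k)
      rw [expPoly, aeval_monomial]
      convert! h1 using 1
      funext l
      rw [← Algebra.smul_def, _root_.smul_pow, smul_smul, smul_mul_smul_comm, ← pow_add, div_eq_mul_inv]
      congr 1
      ring
    have hexp' := (hexp.map (Matrix.entryAddMonoidHom ℂ i j)
      (continuous_id.matrix_elem i j)).mul_left (2 * (Real.pi : ℂ) * Complex.I)
    have hfun : (fun l : ℕ => c * t ^ l / l.factorial *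
        (2 * (Real.pi : ℂ) * Complex.I * (B ^ (k + l)) i j)) =
        fun l => 2 * (Real.pi : ℂ) * Complex.I * (Matrix.entryAddMonoidHom ℂ i j ∘
          fun l : ℕ => (c * t ^ l / l.factorial) • B ^ (k + l)) l := by
      funext l
      simp only [Function.comp_apply, Matrix.entryAddMonoidHom_apply, Matrix.smul_apply,
        smul_eq_mul]
      ring
    rw [hfun] at hsum
    have := hsum.unique hexp'
    rw [entireMatrixFunction, Matrix.of_apply, this, ← mul_assoc, inv_mul_cancel₀ hpi, one_mul]
    rfl

theorem iteratedDeriv_eval_mul_exp (t : ℂ) (N : ℕ) (q : ℂ[X]) :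
    (iteratedDeriv N fun z : ℂ => q.eval z * Complex.exp (z * t)) =
      fun z => ((derivExpPoly t)^[N] q).eval z * Complex.exp (z * t) := by
  induction N generalizing q with
  | zero => simp
  | succ N ih =>
    rw [iteratedDeriv_succ', Function.iterate_succ_apply, ← ih]
    congr 1
    ext z
    have h := (q.hasDerivAt z).mul (((hasDerivAt_id z).mul_const t).cexp)
    refine (HasDerivAt.deriv h).trans ?_
    simp [derivExpPoly]
    ring

end ContourIntegral

/-! ### One-sided moment matching for rational Krylov spaces -/

section MomentMatching

variable {n nhat m : ℕ}

theorem isUnit_smul_one_sub {N : ℕ} {A : Matrix (Fin N) (Fin N) ℂ} {z : ℂ}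
    (hz : z ∉ spectrum ℂ A) : IsUnit (z • (1 : Matrix (Fin N) (Fin N) ℂ) - A) := by
  rwa [spectrum.notMem_iff, Algebra.algebraMap_eq_smul_one] at hz

/-- The polynomial `∏ₖ (z - lam k)^(κ k)`. -/
noncomputable def poleProd (lam : Fin m → ℂ) (κ : Fin m → ℕ) : ℂ[X] :=
  ∏ k, (X - C (lam k)) ^ κ k

theorem polePoly_eq_mul (lam : Fin m → ℂ) (κ χ : Fin m → ℕ) :
    polePoly lam κ χ = poleProd lam κ * poleProd lam χ := by
  simp only [polePoly, poleProd, pow_add, Finset.prod_mul_distrib]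

theorem natDegree_poleProd (lam : Fin m → ℂ) (κ : Fin m → ℕ) :
    (poleProd lam κ).natDegree = ∑ k, κ k := by
  rw [poleProd, natDegree_prod_of_monic _ _ fun k _ => (monic_X_sub_C _).pow _]
  simp

theorem isUnit_aeval_poleProd {N : ℕ} {A : Matrix (Fin N) (Fin N) ℂ} {lam : Fin m → ℂ}
    (h : ∀ k, lam k ∉ spectrum ℂ A) (κ : Fin m → ℕ) : IsUnit (aeval A (poleProd lam κ)) := by
  refine Finset.prod_induction _ (fun p : ℂ[X] => IsUnit (aeval A p))
    (fun p q hp hq => by rw [map_mul]; exact hp.mul hq) (by simp) fun k _ => ?_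
  rw [map_pow, map_sub, aeval_X, aeval_C, ← neg_sub]
  refine (IsUnit.neg ?_).pow _
  rw [Algebra.algebraMap_eq_smul_one]
  exact isUnit_smul_one_sub (h k)

/-- The numerators, over the denominator `poleProd lam κ`, of the rational functions that define
the rational Krylov vectors. -/
noncomputable def krylovNumerator (lam : Fin m → ℂ) (κ₀ : ℕ) (κ : Fin m → ℕ) :
    Fin κ₀ ⊕ (Σ k : Fin m, Fin (κ k)) → ℂ[X] :=
  Sum.elim
    (fun j => X ^ (j : ℕ) * poleProd lam κ)
    (fun p => (-1) ^ ((p.2 : ℕ) + 1) * ((X - C (lam p.1)) ^ (κ p.1 - ((p.2 : ℕ) + 1)) *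
      ∏ k ∈ Finset.univ.erase p.1, (X - C (lam k)) ^ κ k))

/-- A division-free form of numerator over denominator `= (lam - X)^{-(j+1)}`; it yields both the
degree of the numerator and its value at `A`. -/
theorem krylovNumerator_inr_mul (lam : Fin m → ℂ) (κ₀ : ℕ) (κ : Fin m → ℕ)
    (p : Σ k : Fin m, Fin (κ k)) :
    (C (lam p.1) - X) ^ ((p.2 : ℕ) + 1) * krylovNumerator lam κ₀ κ (Sum.inr p) =
      poleProd lam κ := by
  have h1 : (C (lam p.1) - X : ℂ[X]) = (-1) * (X - C (lam p.1)) := by ring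
  have h2 : (p.2 : ℕ) + 1 + (κ p.1 - ((p.2 : ℕ) + 1)) = κ p.1 := by
    have := p.2.2
    omega
  rw [krylovNumerator, Sum.elim_inr, poleProd, ← Finset.mul_prod_erase _ _ (Finset.mem_univ p.1),
    h1, mul_pow]
  calc _ = ((-1 : ℂ[X]) ^ ((p.2 : ℕ) + 1) * (-1) ^ ((p.2 : ℕ) + 1)) *
        ((X - C (lam p.1)) ^ ((p.2 : ℕ) + 1) * (X - C (lam p.1)) ^ (κ p.1 - ((p.2 : ℕ) + 1))) *
        ∏ k ∈ Finset.univ.erase p.1, (X - C (lam k)) ^ κ k := by ring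
    _ = _ := by rw [← pow_add (X - C _), h2, ← mul_pow]; simp

theorem krylovNumerator_mem_degreeLT (lam : Fin m → ℂ) (κ₀ : ℕ) (κ : Fin m → ℕ)
    (i : Fin κ₀ ⊕ (Σ k : Fin m, Fin (κ k))) :
    krylovNumerator lam κ₀ κ i ∈ degreeLT ℂ (κ₀ + ∑ k, κ k) := by
  have hmonic : (poleProd lam κ).Monic :=
    monic_prod_of_monic _ _ fun k _ => (monic_X_sub_C _).pow _
  rw [mem_degreeLT]
  rcases i with j | p
  · rw [krylovNumerator, Sum.elim_inl,
      degree_eq_natDegree (((monic_X_pow _).mul hmonic).ne_zero),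
      (monic_X_pow _).natDegree_mul hmonic, natDegree_X_pow, natDegree_poleProd]
    exact_mod_cast Nat.add_lt_add_right j.2 _
  · have h := krylovNumerator_inr_mul lam κ₀ κ p
    have hne : krylovNumerator lam κ₀ κ (Sum.inr p) ≠ 0 := by
      intro h0
      rw [h0, mul_zero] at h
      exact hmonic.ne_zero h.symm
    have hX : (C (lam p.1) - X : ℂ[X]) ≠ 0 := by
      rw [← neg_sub]
      exact neg_ne_zero.2 (X_sub_C_ne_zero _)
    have hX' : (C (lam p.1) - X : ℂ[X]).natDegree = 1 := by
      rw [← neg_sub, natDegree_neg, natDegree_X_sub_C]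
    have hd := congrArg natDegree h
    rw [natDegree_mul (pow_ne_zero _ hX) hne, natDegree_pow, hX', natDegree_poleProd] at hd
    rw [degree_eq_natDegree hne]
    norm_cast
    omega

theorem krylovVectors_eq {A : Matrix (Fin n) (Fin n) ℂ} (b : Fin n → ℂ)
    {lam : Fin m → ℂ} (κ₀ : ℕ) (κ : Fin m → ℕ) (hlam : ∀ k, lam k ∉ spectrum ℂ A)
    (i : Fin κ₀ ⊕ (Σ k : Fin m, Fin (κ k))) :
    krylovVectors A b lam κ₀ κ i =
      ((aeval A (poleProd lam κ))⁻¹ * aeval A (krylovNumerator lam κ₀ κ i)) *ᵥ b := by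
  have hdet := (Matrix.isUnit_iff_isUnit_det _).1 (isUnit_aeval_poleProd hlam κ)
  rcases i with j | p
  · rw [krylovVectors, krylovNumerator, Sum.elim_inl, Sum.elim_inl, mul_comm (X ^ (j : ℕ)),
      map_mul, Matrix.nonsing_inv_mul_cancel_left _ _ hdet]
    simp
  · have h := congrArg (aeval A) (krylovNumerator_inr_mul lam κ₀ κ p)
    have hu := ((Matrix.isUnit_iff_isUnit_det _).1 (isUnit_smul_one_sub (hlam p.1)))
    rw [map_mul, map_pow, map_sub, aeval_X, aeval_C, Algebra.algebraMap_eq_smul_one] at h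
    rw [krylovVectors, Sum.elim_inr]
    congr 1
    have hcomm : Commute (aeval A (krylovNumerator lam κ₀ κ (Sum.inr p)))
        (aeval A (poleProd lam κ)) := by
      rw [Commute, SemiconjBy, ← map_mul, ← map_mul, mul_comm]
    have h3 : aeval A (krylovNumerator lam κ₀ κ (Sum.inr p)) =
        ((lam p.1 • (1 : Matrix (Fin n) (Fin n) ℂ) - A)⁻¹) ^ ((p.2 : ℕ) + 1) *
          aeval A (poleProd lam κ) := by
      rw [← h, Matrix.inv_pow', ← mul_assoc, Matrix.nonsing_inv_mul, one_mul]
      rw [Matrix.det_pow]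
      exact hu.pow _
    have h4 : aeval A (poleProd lam κ) *
        ((lam p.1 • (1 : Matrix (Fin n) (Fin n) ℂ) - A)⁻¹) ^ ((p.2 : ℕ) + 1) =
        aeval A (krylovNumerator lam κ₀ κ (Sum.inr p)) := by
      have h5 : aeval A (poleProd lam κ) *
        ((lam p.1 • (1 : Matrix (Fin n) (Fin n) ℂ) - A)⁻¹) ^ ((p.2 : ℕ) + 1) *
          aeval A (poleProd lam κ) =
          aeval A (krylovNumerator lam κ₀ κ (Sum.inr p)) * aeval A (poleProd lam κ) := by
        rw [mul_assoc, ← h3, hcomm.eq]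
      exact (isUnit_aeval_poleProd hlam κ).mul_right_cancel h5
    rw [← h4, Matrix.nonsing_inv_mul_cancel_left _ _ hdet]

/-- Projection onto the range of `V`. -/
theorem eq_mulVec_of_mem_range {V : Matrix (Fin n) (Fin nhat) ℂ} (hV : Vᴴ * V = 1)
    {x : Fin n → ℂ} (hx : x ∈ LinearMap.range V.mulVecLin) : x = V *ᵥ (Vᴴ *ᵥ x) := by
  obtain ⟨y, rfl⟩ := hx
  simp only [Matrix.mulVecLin_apply, Matrix.mulVec_mulVec, hV, Matrix.one_mulVec]

/-- Induction on the exponent. If `(lam - A)⁻¹x = Vy`, then `Vᴴx = Vᴴ(lam - A)Vy = (lam - Â)y`, so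
the reduced resolvent recovers `y`; for powers of `A` the projection `VVᴴ` fixes the next vector. -/
theorem krylovVectors_reduced {A : Matrix (Fin n) (Fin n) ℂ} {b : Fin n → ℂ}
    {V : Matrix (Fin n) (Fin nhat) ℂ} (hV : Vᴴ * V = 1)
    {lam : Fin m → ℂ} {κ₀ : ℕ} {κ : Fin m → ℕ} (hlamA : ∀ k, lam k ∉ spectrum ℂ A)
    (hlamR : ∀ k, lam k ∉ spectrum ℂ (reducedMatrix V A))
    (hmem : ∀ i, krylovVectors A b lam κ₀ κ i ∈ LinearMap.range V.mulVecLin)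
    (i : Fin κ₀ ⊕ (Σ k : Fin m, Fin (κ k))) :
    krylovVectors A b lam κ₀ κ i =
      V *ᵥ krylovVectors (reducedMatrix V A) (reducedVector V b) lam κ₀ κ i := by
  rcases i with j | p
  · obtain ⟨j, hj⟩ := j
    induction j with
    | zero =>
      have := eq_mulVec_of_mem_range hV (hmem (Sum.inl ⟨0, hj⟩))
      simpa [krylovVectors, reducedVector] using this
    | succ j ih =>
      have h1 := ih (by omega)
      have h2 := eq_mulVec_of_mem_range hV (hmem (Sum.inl ⟨j + 1, hj⟩))
      simp only [krylovVectors, Sum.elim_inl] at h1 h2 ⊢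
      rw [h2]
      simp only [pow_succ', ← Matrix.mulVec_mulVec]
      rw [h1]
      simp only [reducedMatrix, ← Matrix.mulVec_mulVec]
  · obtain ⟨k, j, hj⟩ := p
    set P := lam k • (1 : Matrix (Fin n) (Fin n) ℂ) - A with hP
    set Q := lam k • (1 : Matrix (Fin nhat) (Fin nhat) ℂ) - reducedMatrix V A with hQ
    have hPu := (Matrix.isUnit_iff_isUnit_det _).1 (isUnit_smul_one_sub (hlamA k))
    have hQu := (Matrix.isUnit_iff_isUnit_det _).1 (isUnit_smul_one_sub (hlamR k))
    have hPQ : Vᴴ * P * V = Q := by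
      rw [hP, hQ, reducedMatrix, Matrix.mul_sub, Matrix.sub_mul, Matrix.mul_smul, Matrix.smul_mul, Matrix.mul_one, hV]
    have hstep : ∀ x : Fin n → ℂ, P⁻¹ *ᵥ x ∈ LinearMap.range V.mulVecLin →
        P⁻¹ *ᵥ x = V *ᵥ (Q⁻¹ *ᵥ (Vᴴ *ᵥ x)) := by
      intro x hx
      obtain ⟨y, hy⟩ := hx
      rw [Matrix.mulVecLin_apply] at hy
      have h1 : x = P *ᵥ (V *ᵥ y) := by
        rw [hy, Matrix.mulVec_mulVec, Matrix.mul_nonsing_inv _ hPu, Matrix.one_mulVec]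
      have h2 : Vᴴ *ᵥ x = Q *ᵥ y := by
        rw [h1, ← hPQ]
        simp only [Matrix.mulVec_mulVec, Matrix.mul_assoc]
      rw [h2, Matrix.mulVec_mulVec y, Matrix.nonsing_inv_mul _ hQu, Matrix.one_mulVec, hy]
    induction j with
    | zero =>
      have := hmem (Sum.inr ⟨k, 0, hj⟩)
      simp only [krylovVectors, Sum.elim_inr, zero_add, pow_one] at this ⊢
      exact hstep b this
    | succ j ih =>
      have h1 := ih (by omega)
      have h2 := hmem (Sum.inr ⟨k, j + 1, hj⟩)
      simp only [krylovVectors, Sum.elim_inr] at h1 h2 ⊢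
      rw [pow_succ', ← Matrix.mulVec_mulVec] at h2 ⊢
      rw [hstep _ h2, pow_succ' _ (j + 1), ← Matrix.mulVec_mulVec, h1]
      congr 2
      rw [Matrix.mulVec_mulVec, hV, Matrix.one_mulVec]

/-- One-sided moment matching: `p(A) v(A)⁻¹ b = V p(Â) v(Â)⁻¹ b̂` for `deg p < κ₀ + deg v`. -/
theorem one_sided_moment_matching {A : Matrix (Fin n) (Fin n) ℂ} {b : Fin n → ℂ}
    {V : Matrix (Fin n) (Fin nhat) ℂ} (hV : Vᴴ * V = 1)
    {lam : Fin m → ℂ} {κ₀ : ℕ} {κ : Fin m → ℕ} (hlamA : ∀ k, lam k ∉ spectrum ℂ A)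
    (hlamR : ∀ k, lam k ∉ spectrum ℂ (reducedMatrix V A))
    (hmem : ∀ i, krylovVectors A b lam κ₀ κ i ∈ LinearMap.range V.mulVecLin)
    (hindep : LinearIndependent ℂ (krylovVectors A b lam κ₀ κ))
    {p : ℂ[X]} (hp : p ∈ degreeLT ℂ (κ₀ + ∑ k, κ k)) :
    ((aeval A (poleProd lam κ))⁻¹ * aeval A p) *ᵥ b =
      V *ᵥ (((aeval (reducedMatrix V A) (poleProd lam κ))⁻¹ * aeval (reducedMatrix V A) p) *ᵥ
        reducedVector V b) := by
  have hspan : degreeLT ℂ (κ₀ + ∑ k, κ k) =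
      Submodule.span ℂ (Set.range (krylovNumerator lam κ₀ κ)) := by
    -- `T` sends the numerators to the Krylov vectors, so their independence pulls back; a dimension
    -- count then makes them a basis of `degreeLT`.
    have hli : LinearIndependent ℂ (krylovNumerator lam κ₀ κ) := by
      let T : ℂ[X] →ₗ[ℂ] (Fin n → ℂ) :=
        { toFun := fun p => ((aeval A (poleProd lam κ))⁻¹ * aeval A p) *ᵥ b
          map_add' := fun p q => by rw [map_add, mul_add, Matrix.add_mulVec]
          map_smul' := fun c p => by
            rw [map_smul, mul_smul_comm, Matrix.smul_mulVec, RingHom.id_apply] }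
      refine LinearIndependent.of_comp T ?_
      convert hindep using 1
      funext i
      exact (krylovVectors_eq b κ₀ κ hlamA i).symm
    have : Module.Finite ℂ (degreeLT ℂ (κ₀ + ∑ k, κ k)) :=
      Module.Finite.equiv (degreeLTEquiv ℂ _).symm
    refine (Submodule.eq_of_le_of_finrank_eq ?_ ?_).symm
    · rw [Submodule.span_le]
      rintro _ ⟨i, rfl⟩
      exact krylovNumerator_mem_degreeLT lam κ₀ κ i
    · rw [finrank_span_eq_card hli, (degreeLTEquiv ℂ _).finrank_eq]
      simp
  rw [hspan] at hp
  induction hp using Submodule.span_induction with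
  | mem x hx =>
    obtain ⟨i, rfl⟩ := hx
    rw [← krylovVectors_eq b κ₀ κ hlamA, ← krylovVectors_eq _ κ₀ κ hlamR]
    exact krylovVectors_reduced hV hlamA hlamR hmem i
  | zero => simp
  | add x y _ _ hx hy =>
    simp only [map_add, mul_add, Matrix.add_mulVec, Matrix.mulVec_add, hx, hy]
  | smul c x _ hx =>
    simp only [map_smul, mul_smul_comm, Matrix.smul_mulVec, Matrix.mulVec_smul, hx]

end MomentMatching

/-! ### Two-sided moment matching and the interpolation nodes -/

section TwoSided

variable {n nhat m : ℕ}

theorem aeval_conjTranspose {N : ℕ} (A : Matrix (Fin N) (Fin N) ℂ) (p : ℂ[X]) :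
    aeval Aᴴ (p.map (starRingEnd ℂ)) = (aeval A p)ᴴ := by
  induction p using Polynomial.induction_on' with
  | add p q hp hq => rw [Polynomial.map_add, map_add, map_add, hp, hq, Matrix.conjTranspose_add]
  | monomial k c =>
    rw [map_monomial, aeval_monomial, aeval_monomial, ← Algebra.smul_def, ← Algebra.smul_def,
      Matrix.conjTranspose_smul, Matrix.conjTranspose_pow]
    rfl

theorem aeval_conjTranspose_poleProd {N : ℕ} (A : Matrix (Fin N) (Fin N) ℂ) (lam : Fin m → ℂ)
    (χ : Fin m → ℕ) :
    aeval Aᴴ (poleProd (fun k => star (lam k)) χ) = (aeval A (poleProd lam χ))ᴴ := by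
  rw [← aeval_conjTranspose]
  congr 1
  simp [poleProd, Polynomial.map_prod]

theorem star_notMem_spectrum_conjTranspose {N : ℕ} {A : Matrix (Fin N) (Fin N) ℂ} {z : ℂ}
    (h : z ∉ spectrum ℂ A) : star z ∉ spectrum ℂ Aᴴ := by
  rw [← Matrix.star_eq_conjTranspose, spectrum.map_star]
  simpa using h

theorem reducedMatrix_conjTranspose (V : Matrix (Fin n) (Fin nhat) ℂ)
    (A : Matrix (Fin n) (Fin n) ℂ) : reducedMatrix V Aᴴ = (reducedMatrix V A)ᴴ := by
  simp [reducedMatrix, Matrix.conjTranspose_mul, Matrix.mul_assoc]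

theorem inv_aeval_mul_aeval_comm {N : ℕ} {A : Matrix (Fin N) (Fin N) ℂ} {q : ℂ[X]}
    (hq : IsUnit (aeval A q)) (p : ℂ[X]) :
    (aeval A q)⁻¹ * aeval A p = aeval A p * (aeval A q)⁻¹ := by
  have h1 : aeval A q * aeval A p = aeval A p * aeval A q := by
    rw [← map_mul, ← map_mul, mul_comm]
  have hdet := (Matrix.isUnit_iff_isUnit_det _).1 hq
  calc (aeval A q)⁻¹ * aeval A p = (aeval A q)⁻¹ * (aeval A p * aeval A q * (aeval A q)⁻¹) := by
        rw [Matrix.mul_nonsing_inv_cancel_right _ _ hdet]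
    _ = _ := by rw [← h1, mul_assoc, Matrix.nonsing_inv_mul_cancel_left _ _ hdet]

theorem star_dotProduct_inv_mul_pow_mulVec {N : ℕ} (A : Matrix (Fin N) (Fin N) ℂ)
    (b d : Fin N → ℂ) {p q : ℂ[X]} (hq : IsUnit (aeval A q)) (hp : IsUnit (aeval A p))
    (i e j : ℕ) :
    star d ⬝ᵥ (((aeval A (p * q))⁻¹ * A ^ (i + e + j)) *ᵥ b) =
      (star d ᵥ* (A ^ i * (aeval A q)⁻¹)) ⬝ᵥ (A ^ e *ᵥ (((aeval A p)⁻¹ * A ^ j) *ᵥ b)) := by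
  have hpow : ∀ k, A ^ k = aeval A ((X : ℂ[X]) ^ k) := by simp
  rw [← Matrix.dotProduct_mulVec, Matrix.mulVec_mulVec, Matrix.mulVec_mulVec, map_mul,
    Matrix.mul_inv_rev]
  congr 2
  rw [pow_add, mul_assoc, ← mul_assoc _ (A ^ (i + e)), hpow (i + e),
    inv_aeval_mul_aeval_comm hp, ← hpow, hpow i, ← inv_aeval_mul_aeval_comm hq, ← hpow, pow_add]
  simp only [mul_assoc]

/-- Two-sided moment matching. -/
theorem two_sided_moment_matching {A : Matrix (Fin n) (Fin n) ℂ} {b d : Fin n → ℂ}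
    {V : Matrix (Fin n) (Fin nhat) ℂ} {lam : Fin m → ℂ} {κ₀ χ₀ : ℕ} {κ χ : Fin m → ℕ}
    (hindep : LinearIndependent ℂ (twoSidedKrylovVectors A b d lam κ₀ χ₀ κ χ))
    (hspan : Submodule.span ℂ (Set.range (twoSidedKrylovVectors A b d lam κ₀ χ₀ κ χ)) =
      LinearMap.range V.mulVecLin)
    (hV : Vᴴ * V = 1)
    (hlamA : ∀ k, lam k ∉ spectrum ℂ A)
    (hlamR : ∀ k, lam k ∉ spectrum ℂ (reducedMatrix V A)) {j : ℕ} (hj : j < nhat) :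
    star d ⬝ᵥ (((aeval A (polePoly lam κ χ))⁻¹ * A ^ j) *ᵥ b) =
      star (reducedVector V d) ⬝ᵥ (((aeval (reducedMatrix V A) (polePoly lam κ χ))⁻¹ *
        reducedMatrix V A ^ j) *ᵥ reducedVector V b) := by
  have hmem : ∀ i, twoSidedKrylovVectors A b d lam κ₀ χ₀ κ χ i ∈ LinearMap.range V.mulVecLin :=
    fun i => hspan ▸ Submodule.subset_span ⟨i, rfl⟩
  have hcard : nhat = (κ₀ + ∑ k, κ k) + (χ₀ + ∑ k, χ k) := by
    have hinj : Function.Injective V.mulVecLin := by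
      intro x y hxy
      have h := congrArg (fun z => Vᴴ *ᵥ z) hxy
      simpa [Matrix.mulVec_mulVec, hV] using h
    have h1 := LinearMap.finrank_range_of_inj hinj
    rw [← hspan, finrank_span_eq_card hindep] at h1
    simpa using h1.symm
  have hcol : ∀ i < κ₀ + ∑ k, κ k, ((aeval A (poleProd lam κ))⁻¹ * A ^ i) *ᵥ b =
      V *ᵥ (((aeval (reducedMatrix V A) (poleProd lam κ))⁻¹ * reducedMatrix V A ^ i) *ᵥ
        reducedVector V b) := by
    intro i hi
    have := one_sided_moment_matching (p := X ^ i) hV hlamA hlamR (fun i => hmem (Sum.inl i))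
      (hindep.comp Sum.inl Sum.inl_injective) (by rw [mem_degreeLT, degree_X_pow]; exact_mod_cast hi)
    simpa using this
  -- One-sided matching for `Aᴴ`, `d` and the conjugate poles, then conjugate-transposed.
  have hrow : ∀ i < χ₀ + ∑ k, χ k, star d ᵥ* (A ^ i * (aeval A (poleProd lam χ))⁻¹) =
      (star (reducedVector V d) ᵥ* (reducedMatrix V A ^ i *
        (aeval (reducedMatrix V A) (poleProd lam χ))⁻¹)) ᵥ* Vᴴ := by
    intro i hi
    have := one_sided_moment_matching (p := X ^ i) hV
      (fun k => star_notMem_spectrum_conjTranspose (hlamA k))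
      (fun k => by
        rw [reducedMatrix_conjTranspose]
        exact star_notMem_spectrum_conjTranspose (hlamR k))
      (fun i => hmem (Sum.inr i))
      (hindep.comp Sum.inr Sum.inr_injective) (by rw [mem_degreeLT, degree_X_pow]; exact_mod_cast hi)
    have h2 := congrArg star this
    rw [reducedMatrix_conjTranspose, aeval_conjTranspose_poleProd,
      aeval_conjTranspose_poleProd] at h2
    simpa [Matrix.star_mulVec, Matrix.conjTranspose_mul, Matrix.conjTranspose_nonsing_inv] using h2
  have hunitA := fun κ => isUnit_aeval_poleProd hlamA κ
  have hunitR := fun κ => isUnit_aeval_poleProd hlamR κ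
  rw [polePoly_eq_mul]
  have hbasic : ∀ i e l, i + e + l = j → (star d ᵥ* (A ^ i * (aeval A (poleProd lam χ))⁻¹)) ⬝ᵥ
      (A ^ e *ᵥ (((aeval A (poleProd lam κ))⁻¹ * A ^ l) *ᵥ b)) =
      (star (reducedVector V d) ᵥ* (reducedMatrix V A ^ i *
        (aeval (reducedMatrix V A) (poleProd lam χ))⁻¹)) ⬝ᵥ (reducedMatrix V A ^ e *ᵥ
        (((aeval (reducedMatrix V A) (poleProd lam κ))⁻¹ * reducedMatrix V A ^ l) *ᵥ
        reducedVector V b)) →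
      star d ⬝ᵥ (((aeval A (poleProd lam κ * poleProd lam χ))⁻¹ * A ^ j) *ᵥ b) =
      star (reducedVector V d) ⬝ᵥ (((aeval (reducedMatrix V A)
        (poleProd lam κ * poleProd lam χ))⁻¹ * reducedMatrix V A ^ j) *ᵥ reducedVector V b) := by
    rintro i e l rfl h
    rw [star_dotProduct_inv_mul_pow_mulVec A b d (hunitA χ) (hunitA κ), h,
      star_dotProduct_inv_mul_pow_mulVec _ _ _ (hunitR χ) (hunitR κ)]
  -- If one family is empty, its denominator is `1` and the other family alone covers all `j <
  -- nhat`.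
  rcases Nat.eq_zero_or_pos (κ₀ + ∑ k, κ k) with h1 | h1
  · have hκ : ∀ k, κ k = 0 := by
      have : ∑ k, κ k = 0 := by omega
      simpa using this
    refine hbasic j 0 0 (by simp) ?_
    rw [hrow j (by omega), ← Matrix.dotProduct_mulVec]
    simp [poleProd, hκ, reducedVector]
  rcases Nat.eq_zero_or_pos (χ₀ + ∑ k, χ k) with h2 | h2
  · have hχ : ∀ k, χ k = 0 := by
      have : ∑ k, χ k = 0 := by omega
      simpa using this
    refine hbasic 0 0 j (by simp) ?_
    rw [hcol j (by omega)]
    simp [poleProd, hχ, reducedVector, Matrix.star_mulVec, Matrix.dotProduct_mulVec]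
  -- The two sides reach exponent `nhat - 2` together; the middle factor `A ^ e` supplies the
  -- missing one.
  obtain ⟨i, e, l, he, hi, hl, hsum⟩ : ∃ i e l, (e = 0 ∨ e = 1) ∧ i < χ₀ + ∑ k, χ k ∧
      l < κ₀ + ∑ k, κ k ∧ i + e + l = j := by
    by_cases hjl : j < κ₀ + ∑ k, κ k
    · exact ⟨0, 0, j, Or.inl rfl, h2, hjl, by simp⟩
    · exact ⟨j - (κ₀ + ∑ k, κ k), 1, (κ₀ + ∑ k, κ k) - 1, Or.inr rfl, by omega, by omega, by omega⟩
  refine hbasic i e l hsum ?_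
  rw [hrow i hi, hcol l hl, ← Matrix.dotProduct_mulVec, Matrix.mulVec_mulVec _ (A ^ e) V,
    Matrix.mulVec_mulVec _ Vᴴ, ← Matrix.mul_assoc]
  rcases he with rfl | rfl
  · simp [hV]
  · simp [reducedMatrix]

/-- The remainder estimate peels nodes off a list, so each eigenvalue is repeated according to its
multiplicity. -/
theorem exists_list_nodes {N mhat : ℕ} {B : Matrix (Fin N) (Fin N) ℂ} {μ : Fin mhat → ℂ}
    {w : Fin mhat → ℕ} (hμ_inj : Function.Injective μ) (hμ_range : Set.range μ = spectrum ℂ B)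
    (hw : ∀ k, w k = B.charpoly.rootMultiplicity (μ k)) :
    ∃ l : List ℂ, l.length = N ∧ (∀ z ∈ l, z ∈ Set.range μ) ∧
      (l.map fun z => X - C z).prod = nodePoly μ w ∧ nodePoly μ w = B.charpoly := by
  have hmonic := B.charpoly_monic
  have hsplit : (B.charpoly.roots.map fun z => X - C z).prod = B.charpoly :=
    ((IsAlgClosed.splits B.charpoly).eq_prod_roots_of_monic hmonic).symm
  have hroot : ∀ z, z ∈ B.charpoly.roots ↔ z ∈ Set.range μ := by
    intro z
    rw [hμ_range, mem_roots hmonic.ne_zero, Matrix.mem_spectrum_iff_isRoot_charpoly]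
  have hnode : nodePoly μ w = B.charpoly := by
    have himage : B.charpoly.roots.toFinset = Finset.univ.image μ := by
      ext z
      simp [-mem_roots', hroot]
    rw [← hsplit, Finset.prod_multiset_map_count, himage,
      Finset.prod_image fun _ _ _ _ h => hμ_inj h, nodePoly]
    refine Finset.prod_congr rfl fun k _ => ?_
    rw [hw k, count_roots]
  refine ⟨B.charpoly.roots.toList, ?_, ?_, ?_, hnode⟩
  · rw [Multiset.length_toList, ← (IsAlgClosed.splits B.charpoly).natDegree_eq_card_roots,
      Matrix.charpoly_natDegree_eq_dim, Fintype.card_fin]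
  · intro z hz
    exact (hroot z).1 (Multiset.mem_toList.1 hz)
  · rw [hnode, ← hsplit]
    conv_rhs => rw [← Multiset.coe_toList B.charpoly.roots, Multiset.map_coe, Multiset.prod_coe]
    rw [hsplit]

end TwoSided

/-! ### From the interpolation remainder to the error term -/

section ErrorBound

open scoped Matrix.Norms.Operator

variable {n : ℕ}

theorem continuous_expPoly {𝒜 : Type*} [NormedRing 𝒜] [NormedAlgebra ℂ 𝒜] [CompleteSpace 𝒜]
    (t : ℂ) (q : ℂ[X]) : Continuous (expPoly t q : 𝒜 → 𝒜) := by
  let _ : NormedAlgebra ℚ 𝒜 := NormedAlgebra.restrictScalars ℚ ℂ 𝒜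
  exact (q.continuous_aeval).mul (NormedSpace.exp_continuous.comp (continuous_const_smul t))

theorem map_expPoly {𝒜 ℬ : Type*} [NormedRing 𝒜] [NormedAlgebra ℂ 𝒜] [CompleteSpace 𝒜]
    [NormedRing ℬ] [NormedAlgebra ℂ ℬ] (f : 𝒜 →ₐ[ℂ] ℬ) (hf : Continuous f) (t : ℂ) (q : ℂ[X])
    (x : 𝒜) : f (expPoly t q x) = expPoly t q (f x) := by
  let _ : NormedAlgebra ℚ 𝒜 := NormedAlgebra.restrictScalars ℚ ℂ 𝒜
  let _ : NormedAlgebra ℚ ℬ := NormedAlgebra.restrictScalars ℚ ℂ ℬ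
  rw [expPoly, expPoly, map_mul, NormedSpace.map_exp f hf, map_smul, aeval_algHom_apply]

/-- The Hermite interpolation error bound for a pair of functionals on two algebras that agree on
low powers, when the node polynomial annihilates the second element. -/
theorem norm_sub_expPoly_le {𝒜 ℬ : Type*} [NormedRing 𝒜] [NormedAlgebra ℂ 𝒜]
    [FiniteDimensional ℂ 𝒜] [NormedRing ℬ] [NormedAlgebra ℂ ℬ] [FiniteDimensional ℂ ℬ]
    (t : ℂ) (q : ℂ[X]) (a : 𝒜) (b : ℬ) {K : Set ℂ} (hK : Convex ℝ K) {M : ℝ} {l : List ℂ}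
    {φ : 𝒜 → ℂ} {ψ : ℬ → ℂ} (hφ : IsLinearMap ℂ φ) (hψ : IsLinearMap ℂ ψ)
    (hne : K.Nonempty) (hl : ∀ μ ∈ l, μ ∈ K) (hpow : ∀ j < l.length, φ (a ^ j) = ψ (b ^ j))
    (hb : aeval b (l.map fun μ => X - C μ).prod = 0)
    (hM : ∀ s ∈ Set.Icc (0 : ℝ) 1, ∀ μ ∈ K,
      ‖φ (aeval a (l.map fun μ => X - C μ).prod * expPoly t ((derivExpPoly t)^[l.length] q)
        (algebraMap ℂ 𝒜 ((1 - s) * μ) + (s : ℂ) • a))‖ ≤ M) :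
    ‖φ (expPoly t q a) - ψ (expPoly t q b)‖ ≤ M / l.length.factorial := by
  have : CompleteSpace 𝒜 := FiniteDimensional.complete ℂ 𝒜
  have : CompleteSpace ℬ := FiniteDimensional.complete ℂ ℬ
  -- Working in the product algebra turns agreement of `φ` and `ψ` on powers into vanishing of one
  -- functional.
  set Ψ : 𝒜 × ℬ →L[ℂ] ℂ := (hφ.mk' φ).toContinuousLinearMap.comp (ContinuousLinearMap.fst ℂ 𝒜 ℬ) -
    (hψ.mk' ψ).toContinuousLinearMap.comp (ContinuousLinearMap.snd ℂ 𝒜 ℬ)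
  have hΨ : ∀ x, Ψ x = φ x.1 - ψ x.2 := fun _ => rfl
  have hfst : ∀ q x, (expPoly t q x : 𝒜 × ℬ).1 = expPoly t q x.1 := fun q x =>
    map_expPoly (AlgHom.fst ℂ 𝒜 ℬ) continuous_fst t q x
  have hsnd : ∀ q x, (expPoly t q x : 𝒜 × ℬ).2 = expPoly t q x.2 := fun q x =>
    map_expPoly (AlgHom.snd ℂ 𝒜 ℬ) continuous_snd t q x
  have hΩfst : ∀ p : ℂ[X], (aeval (a, b) p).1 = aeval a p := fun p =>
    (aeval_algHom_apply (AlgHom.fst ℂ 𝒜 ℬ) (a, b) p).symm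
  have hΩsnd : ∀ p : ℂ[X], (aeval (a, b) p).2 = aeval b p := fun p =>
    (aeval_algHom_apply (AlgHom.snd ℂ 𝒜 ℬ) (a, b) p).symm
  have key := norm_apply_expPoly_le t (a, b) hK (M := M) l Ψ q hl
    (fun j hj => by rw [hΨ, Prod.pow_fst, Prod.pow_snd, hpow j hj, sub_self])
    (fun s hs c hc => by
      obtain ⟨μ, hμ, rfl⟩ := hc
      rw [hΨ, Prod.fst_mul, Prod.snd_mul, hΩfst, hΩsnd, hb, zero_mul, hψ.map_zero, sub_zero, hfst]
      simpa using hM s hs μ hμ)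
    -- At `r = 1`, `c = 0` the point is `(a, b)` itself; `0 ∈ 0 • K` because `K` is nonempty.
    1 ⟨zero_le_one, le_rfl⟩ 0 (by
      obtain ⟨μ, hμ⟩ := hne
      exact ⟨μ, hμ, by simp⟩)
  rw [hΨ, hfst, hsnd] at key
  simpa using key

theorem isLinearMap_star_dotProduct_mulVec {N : ℕ} (W : Matrix (Fin N) (Fin N) ℂ)
    (b d : Fin N → ℂ) :
    IsLinearMap ℂ fun Y : Matrix (Fin N) (Fin N) ℂ => star d ⬝ᵥ ((W * Y) *ᵥ b) where
  map_add x y := by rw [mul_add, Matrix.add_mulVec, dotProduct_add]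
  map_smul c x := by rw [mul_smul_comm, Matrix.smul_mulVec, dotProduct_smul]

theorem errorTerm_eq (A : Matrix (Fin n) (Fin n) ℂ) (b d : Fin n → ℂ) (Ω v : ℂ[X]) (N : ℕ)
    (t s : ℝ) (μ : ℂ) :
    errorTerm A b d Ω v N t s μ = ‖star d ⬝ᵥ ((aeval A Ω * (aeval A v)⁻¹ *
      ((N.factorial : ℂ)⁻¹ • expPoly (t : ℂ) ((derivExpPoly (t : ℂ))^[N] v)
        (algebraMap ℂ _ ((1 - (s : ℂ)) * μ) + (s : ℂ) • A))) *ᵥ b)‖ := by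
  rw [errorTerm, iteratedDeriv_eval_mul_exp, entireMatrixFunction_eval_mul_exp,
    Algebra.algebraMap_eq_smul_one]

theorem continuous_errorTerm (A : Matrix (Fin n) (Fin n) ℂ) (b d : Fin n → ℂ) (Ω v : ℂ[X])
    (N : ℕ) (t : ℝ) : Continuous fun x : ℝ × ℂ => errorTerm A b d Ω v N t x.1 x.2 := by
  simp only [errorTerm_eq]
  have h1 : Continuous fun x : ℝ × ℂ => algebraMap ℂ (Matrix (Fin n) (Fin n) ℂ)
      ((1 - (x.1 : ℂ)) * x.2) + (x.1 : ℂ) • A := by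
    simp only [Algebra.algebraMap_eq_smul_one]
    fun_prop
  have h2 := (continuous_expPoly (t : ℂ) ((derivExpPoly (t : ℂ))^[N] v)).comp h1
  have h3 := (continuous_const (y := aeval A Ω * (aeval A v)⁻¹)).mul
    (h2.const_smul (N.factorial : ℂ)⁻¹)
  exact ((continuous_const (y := star d)).dotProduct
    (Continuous.matrix_mulVec h3 (continuous_const (y := b)))).norm

end ErrorBound

open scoped Matrix.Norms.Operator in
theorem theoremt {n nhat m mhat : ℕ} (hnhat : 0 < nhat)
    (A : Matrix (Fin n) (Fin n) ℂ) (b d : Fin n → ℂ)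
    (V : Matrix (Fin n) (Fin nhat) ℂ)
    (lam : Fin m → ℂ) (κ₀ χ₀ : ℕ) (κ χ : Fin m → ℕ)
    -- the Krylov vectors form a basis in the image of `V`
    (hindep : LinearIndependent ℂ (twoSidedKrylovVectors A b d lam κ₀ χ₀ κ χ))
    (hspan : Submodule.span ℂ (Set.range (twoSidedKrylovVectors A b d lam κ₀ χ₀ κ χ)) =
      LinearMap.range V.mulVecLin)
    (hV : Vᴴ * V = 1)
    -- the poles lie neither in the spectrum of `A` nor in that of the reduced matrix
    (hlamA : ∀ k, lam k ∉ spectrum ℂ A)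
    (hlamR : ∀ k, lam k ∉ spectrum ℂ (reducedMatrix V A))
    -- the eigenvalues of the reduced matrix, with their algebraic multiplicities
    (μhat : Fin mhat → ℂ) (what : Fin mhat → ℕ)
    (hμ_inj : Function.Injective μhat)
    (hμ_range : Set.range μhat = spectrum ℂ (reducedMatrix V A))
    (hwhat : ∀ k, what k = (reducedMatrix V A).charpoly.rootMultiplicity (μhat k))
    (t : ℝ) :
    ∃ M : ℝ,
      IsGreatest
        {x : ℝ | ∃ s ∈ Set.Icc (0 : ℝ) 1, ∃ μ ∈ convexHull ℝ (Set.range μhat),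
          x = errorTerm A b d (nodePoly μhat what) (polePoly lam κ χ) nhat t s μ} M ∧
      ‖impulseResponse A b d t -
        impulseResponse (reducedMatrix V A) (reducedVector V b) (reducedVector V d) t‖ ≤ M := by
  set B := reducedMatrix V A with hB
  set v := polePoly lam κ χ with hv
  set Ω := nodePoly μhat what with hΩdef
  obtain ⟨l, hlen, hlmem, hΩ, hchar⟩ := exists_list_nodes hμ_inj hμ_range hwhat
  rw [← hΩdef] at hΩ hchar
  have hne : (Set.range μhat).Nonempty := by
    obtain ⟨z, hz⟩ := List.exists_mem_of_length_pos (hlen ▸ hnhat)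
    exact ⟨z, hlmem z hz⟩
  have hset : {x : ℝ | ∃ s ∈ Set.Icc (0 : ℝ) 1, ∃ μ ∈ convexHull ℝ (Set.range μhat),
      x = errorTerm A b d Ω v nhat t s μ} =
      (fun x : ℝ × ℂ => errorTerm A b d Ω v nhat t x.1 x.2) ''
        (Set.Icc (0 : ℝ) 1 ×ˢ convexHull ℝ (Set.range μhat)) := by
    ext x
    constructor
    · rintro ⟨s, hs, μ, hμ, rfl⟩
      exact ⟨(s, μ), ⟨hs, hμ⟩, rfl⟩
    · rintro ⟨⟨s, μ⟩, ⟨hs, hμ⟩, rfl⟩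
      exact ⟨s, hs, μ, hμ, rfl⟩
  have hcompact : IsCompact (Set.Icc (0 : ℝ) 1 ×ˢ convexHull ℝ (Set.range μhat)) :=
    isCompact_Icc.prod ((Set.finite_range μhat).isCompact_convexHull ℝ)
  obtain ⟨M, hM⟩ := (hcompact.image (continuous_errorTerm A b d Ω v nhat t)).exists_isGreatest
    (((Set.nonempty_Icc.2 zero_le_one).prod (hne.mono (subset_convexHull ℝ _))).image _)
  rw [← hset] at hM
  refine ⟨M, hM, ?_⟩
  have hvA : IsUnit (aeval A v) := by
    rw [hv, polePoly_eq_mul, map_mul]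
    exact (isUnit_aeval_poleProd hlamA κ).mul (isUnit_aeval_poleProd hlamA χ)
  have hvB : IsUnit (aeval B v) := by
    rw [hv, polePoly_eq_mul, map_mul]
    exact (isUnit_aeval_poleProd hlamR κ).mul (isUnit_aeval_poleProd hlamR χ)
  -- The factor `nhat!` in the bound offsets the `1 / nhat!` already inside `errorTerm`.
  have key := norm_sub_expPoly_le (t : ℂ) v A B (convex_convexHull ℝ (Set.range μhat))
    (M := nhat.factorial * M) (l := l)
    (isLinearMap_star_dotProduct_mulVec (aeval A v)⁻¹ b d)
    (isLinearMap_star_dotProduct_mulVec (aeval B v)⁻¹ (reducedVector V b) (reducedVector V d))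
    (hne.mono (subset_convexHull ℝ _)) (fun μ hμ => subset_convexHull ℝ _ (hlmem μ hμ))
    (fun j hj => two_sided_moment_matching hindep hspan hV hlamA hlamR (hlen ▸ hj))
    (by rw [hΩ, hchar]; exact Matrix.aeval_self_charpoly B)
    (fun s hs μ hμ => by
      have h1 := hM.2 ⟨s, hs, μ, hμ, rfl⟩
      rw [errorTerm_eq, mul_smul_comm, Matrix.smul_mulVec, dotProduct_smul, norm_smul, norm_inv,
        Complex.norm_natCast, inv_mul_le_iff₀ (by positivity)] at h1
      rw [hΩ, hlen, ← mul_assoc, inv_aeval_mul_aeval_comm hvA]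
      exact h1)
  rw [hlen, mul_div_cancel_left₀ _ (by positivity)] at key
  have hval : ∀ {N : ℕ} {C : Matrix (Fin N) (Fin N) ℂ}, IsUnit (aeval C v) →
      (aeval C v)⁻¹ * expPoly (t : ℂ) v C = NormedSpace.exp ((t : ℂ) • C) := fun hC => by
    rw [expPoly, Matrix.nonsing_inv_mul_cancel_left _ _ ((Matrix.isUnit_iff_isUnit_det _).1 hC)]
    rfl
  rw [hval hvA, hval hvB] at key
  exact key
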